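/- A virtual knot is an equivalence class of (unoriented) virtual knot diagrams, i.e. diagrams with classical and virtual crossings, modulo the generalized Reidemeister moves; equivalently, a class of signed Gauss codes (read from any base point and in either direction) modulo the three classical Reidemeister moves. An arc of a diagram is a segment passing through exactly two consecutive crossings, each of them classical or virtual. An arc shift move cuts out an arc at its two ends and glues it back with its ends interchanged, the connecting strands meeting the rest of the diagram in virtual crossings only; in the Gauss code, this interchanges the two passages and changes the signs of those of the two crossings that are classical (the virtual crossings being absent from the code). For virtual knots $K,L$ let $d_A(K,L)$ be the minimal number of arc shift moves which, together with generalized Reidemeister moves, turn a diagram of $K$ into a diagram of $L$. Theorem. There exists an infinite family of virtual knots $\{VK_n\}_{n\ge 1}$ such that $d_A(VK_t,VK_s)=1$ for all distinct $t,s\ge 1$. -/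

import Mathlib

/-!
Virtual knots are taken as Gauss codes (Gauss diagrams) modulo Reidemeister moves. The generalized
Reidemeister moves are the three classical moves together with the detour moves; detour moves reroute
strands through virtual crossings, and two planar virtual knot diagrams are related by detour moves
exactly if they have the same Gauss code, every abstract Gauss code being the code of some planar
virtual diagram. Virtual crossings therefore leave no trace in the code, and the code of an
(unoriented) diagram is defined up to the choice of base point, direction and names of crossings.
-/

/-- One passage of the knot through a classical crossing: the name of the crossing, whether it is
passed on the upper strand (`isOver = true`) or on the lower one, and the sign of the crossing. -/
@[ext]
structure Passage where
  crossing : ℕ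
  isOver : Bool
  sign : ℤˣ

/-- A word of passages is a Gauss code if every crossing that occurs is passed exactly twice, once
over and once under, and has one and the same sign at both passages. -/
def IsGaussCode (w : List Passage) : Prop :=
  w.Nodup ∧ ∀ p ∈ w, (⟨p.crossing, !p.isOver, p.sign⟩ : Passage) ∈ w ∧
    ∀ q ∈ w, q.crossing = p.crossing → q.sign = p.sign

/-- The signed Gauss codes: the classical crossings of a virtual knot diagram, listed as they are met
in one turn along the knot. The empty code is that of a diagram without classical crossings. -/
structure GaussCode where
  word : List Passage
  isGaussCode : IsGaussCode word

/-- Two passages in the order `p, q` if `ε = 1`, and in the order `q, p` if `ε = -1`. -/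
def inOrder (ε : ℤˣ) (p q : Passage) : List Passage :=
  if ε = 1 then [p, q] else [q, p]

/-- In a triangle with crossings `x` (top strand over middle strand), `y` (top over bottom) and `z`
(middle over bottom): the piece of the top strand, meeting `x` first if `α = 1`, `y` first if `α = -1`. -/
def topStrand (x y : ℕ) (sx sy α : ℤˣ) : List Passage :=
  inOrder α ⟨x, true, sx⟩ ⟨y, true, sy⟩

/-- The piece of the middle strand, meeting `x` first if `β = 1` and `z` first if `β = -1`. -/
def middleStrand (x z : ℕ) (sx sz β : ℤˣ) : List Passage :=
  inOrder β ⟨x, false, sx⟩ ⟨z, true, sz⟩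

/-- The piece of the bottom strand, meeting `y` first if `γ = 1` and `z` first if `γ = -1`. -/
def bottomStrand (y z : ℕ) (sy sz γ : ℤˣ) : List Passage :=
  inOrder γ ⟨y, false, sy⟩ ⟨z, false, sz⟩

/-- The elementary changes of a Gauss code that do not change the virtual knot. -/
inductive ReidemeisterMove : List Passage → List Passage → Prop
  /-- change of the base point -/
  | rotate (u v : List Passage) : ReidemeisterMove (u ++ v) (v ++ u)
  /-- reading the diagram in the other direction; over, under and signs stay the same -/
  | reverse (w : List Passage) : ReidemeisterMove w w.reverse
  /-- renaming the crossings -/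
  | rename (σ : Equiv.Perm ℕ) (w : List Passage) :
      ReidemeisterMove w (w.map fun p => ⟨σ p.crossing, p.isOver, p.sign⟩)
  /-- the first Reidemeister move: a kink, of either sign, passed over or under first -/
  | r1 (c : ℕ) (o : Bool) (s : ℤˣ) (u v : List Passage) :
      ReidemeisterMove (u ++ v) (u ++ [⟨c, o, s⟩, ⟨c, !o, s⟩] ++ v)
  /-- the second Reidemeister move: one strand passes over the other at two consecutive crossings,
  which have opposite signs; the strands run in the same direction (`ε = 1`) or in opposite
  directions (`ε = -1`) -/
  | r2 (a b : ℕ) (o : Bool) (s ε : ℤˣ) (u v w : List Passage) :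
      ReidemeisterMove (u ++ v ++ w)
        (u ++ [⟨a, o, s⟩, ⟨b, o, -s⟩] ++ v ++ inOrder ε ⟨a, !o, s⟩ ⟨b, !o, -s⟩ ++ w)
  /-- the third Reidemeister move, the three strands being met in the cyclic order top, middle,
  bottom; the two equations say that orders and signs are those of three lines in the plane that
  form a triangle -/
  | r3 (x y z : ℕ) (sx sy sz α β γ : ℤˣ) (hxz : α * sx = γ * sz) (hxy : β * sx = γ * sy)
      (u v w : List Passage) :
      ReidemeisterMove
        (topStrand x y sx sy α ++ u ++ middleStrand x z sx sz β ++ v ++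
          bottomStrand y z sy sz γ ++ w)
        (topStrand x y sx sy (-α) ++ u ++ middleStrand x z sx sz (-β) ++ v ++
          bottomStrand y z sy sz (-γ) ++ w)
  /-- the same, the three strands being met in the cyclic order top, bottom, middle -/
  | r3' (x y z : ℕ) (sx sy sz α β γ : ℤˣ) (hxz : α * sx = γ * sz) (hxy : β * sx = γ * sy)
      (u v w : List Passage) :
      ReidemeisterMove
        (topStrand x y sx sy α ++ u ++ bottomStrand y z sy sz γ ++ v ++
          middleStrand x z sx sz β ++ w)
        (topStrand x y sx sy (-α) ++ u ++ bottomStrand y z sy sz (-γ) ++ v ++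
          middleStrand x z sx sz (-β) ++ w)

/-- Equivalence of Gauss codes: the equivalence relation generated by the moves. All codes on the way
are honest Gauss codes. -/
def virtualKnotSetoid : Setoid GaussCode :=
  Relation.EqvGen.setoid fun D D' => ReidemeisterMove D.word D'.word

/-- A virtual knot: an equivalence class of diagrams modulo generalized Reidemeister moves. -/
def VirtualKnot : Type := Quotient virtualKnotSetoid

/-- `D.Represents K`: the code `D` is that of a diagram of the virtual knot `K`. -/
def GaussCode.Represents (D : GaussCode) (K : VirtualKnot) : Prop :=
  Quotient.mk virtualKnotSetoid D = K

/-- Change the sign of the crossing `c`, at both of its passages; over and under stay as they are. -/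
def flipSign (c : ℕ) (w : List Passage) : List Passage :=
  w.map fun p => if p.crossing = c then ⟨p.crossing, p.isOver, -p.sign⟩ else p

/-- One arc shift move. An arc is a segment of the diagram through exactly two consecutive crossings,
each classical or virtual. It is cut off at its two ends and glued in again the other way round, the
new connections being led through virtual crossings only. So its two crossings are now passed in the
opposite order, and since there one of the two strands has changed its direction, the classical ones
among them change sign, while over and under stay as they are.
An arc through two virtual crossings, or twice through the same crossing, is not listed: its shift does
not change the virtual knot. -/
inductive ArcShiftMove : GaussCode → GaussCode → Prop
  /-- both crossings of the arc are classical -/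
  | classical (D D' : GaussCode) (p q : Passage) (u v : List Passage)
      (hne : p.crossing ≠ q.crossing) (hD : D.word = u ++ [p, q] ++ v)
      (hD' : D'.word = flipSign p.crossing (flipSign q.crossing (u ++ [q, p] ++ v))) :
      ArcShiftMove D D'
  /-- one crossing of the arc is the classical crossing `c`, the other one is virtual -/
  | mixed (D D' : GaussCode) (c : ℕ) (hc : ∃ p ∈ D.word, p.crossing = c)
      (hD' : D'.word = flipSign c D.word) :
      ArcShiftMove D D'

/-- Some diagram of `K` is turned into some diagram of `L` by one arc shift move. -/
def ArcShiftAdjacent (K L : VirtualKnot) : Prop :=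
  ∃ D D' : GaussCode, D.Represents K ∧ D'.Represents L ∧ ArcShiftMove D D'

/-- `K` is turned into `L` by `n` arc shift moves (and generalized Reidemeister moves). -/
def ArcShiftReachable : ℕ → VirtualKnot → VirtualKnot → Prop
  | 0, K, L => K = L
  | n + 1, K, L => ∃ M, ArcShiftReachable n K M ∧ ArcShiftAdjacent M L

/-- The arc shift distance: the least number of arc shift moves that turn a diagram of `K` into a
diagram of `L` (`⊤` if there were no such number). -/
noncomputable def arcShiftDist (K L : VirtualKnot) : ℕ∞ :=
  sInf {m : ℕ∞ | ∃ n : ℕ, m = n ∧ ArcShiftReachable n K L}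

/-!
The virtual knots are the classes of `chain j`, a chain of `j` gadgets of four crossings each, with a
single further crossing that locks its lower end. In each gadget all upper passages `a c b d` are adjacent, and the lower
passages `a b … c d` enclose the upper passages of the next gadget; `a`, `b` are positive, `c`, `d`
negative. If the enclosed passages were missing, `b` and `c` and then `a` and `d` would cancel by second
Reidemeister moves, so a gadget that disappears takes all gadgets above it with it
(`exists_context`). One arc shift makes any given gadget disappear: interchanging `c` and `b`
changes their signs and turns the upper passages into `a b c d`, and now `a` cancels with `b` and `c`
with `d`, whatever is enclosed. What is left is the chain of the gadgets below, so that the chain of `j`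
gadgets is turned into the chain of `i` gadgets for any `i < j` (`arcShiftAdjacent_chain`).

The chains of different positive lengths are different virtual knots. They are told apart by the linear
Alexander biquandle over a commutative ring `R` with a unit `t`: a colour `x` becomes `-x` at an
over-passage and `t ^ s * x + (1 + t ^ s) * k` at an under-passage of sign `s`, where `k` is the incoming
colour of the upper strand. The existence of a colouring not annihilated by a fixed `r : R` is
invariant under all moves, except that reversal replaces `t` by `t⁻¹`
(`colourableUpToInv_iff_of_mk_eq`). In the chain of `j ≥ 1` gadgets a colouring is determined by the
colour `z` at the base point, and it closes up exactly if `2 * (t - 1) * (1 + t) ^ (2 * j + 1) * z = 0`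
(`Transports.eq_exitColour`). For `t = 2` and for `t = 1 / 2` this says `3 ^ (2 * j + 1) * z = 0` in
`ZMod (3 ^ N)`, so that for `N ≥ 1` there is a colouring with `3 ^ (N - 1) * z ≠ 0` if and
only if `N ≤ 2 * j + 1`.
-/

/-! ### Gauss codes as collections of chords -/

theorem IsGaussCode.perm {w w' : List Passage} (hw : IsGaussCode w) (h : w.Perm w') :
    IsGaussCode w' := by
  refine ⟨h.nodup_iff.1 hw.1, fun p hp => ?_⟩
  obtain ⟨h1, h2⟩ := hw.2 p (h.mem_iff.2 hp)
  exact ⟨h.mem_iff.1 h1, fun q hq => h2 q (h.mem_iff.2 hq)⟩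

/-- A crossing may be added to a Gauss code if its name is new, and any crossing may be deleted. By
`IsGaussCode.perm` the position of its two passages is irrelevant. -/
theorem isGaussCode_cons_cons_iff {c : ℕ} {o : Bool} {s : ℤˣ} {w : List Passage} :
    IsGaussCode (⟨c, o, s⟩ :: ⟨c, !o, s⟩ :: w) ↔ IsGaussCode w ∧ ∀ p ∈ w, p.crossing ≠ c := by
  constructor
  · rintro ⟨hn, h⟩
    have hne : ∀ p ∈ w, p.crossing ≠ c := by
      intro p hp hc
      have hs := (h ⟨c, o, s⟩ (by simp)).2 p (by simp [hp]) hc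
      simp only [List.nodup_cons, List.mem_cons, not_or] at hn
      have hp' : p = ⟨c, o, s⟩ ∨ p = ⟨c, !o, s⟩ := by
        obtain ⟨pc, po, ps⟩ := p
        simp only at hc hs
        subst hc hs
        cases po <;> cases o <;> simp
      rcases hp' with rfl | rfl
      · exact hn.1.2 hp
      · exact hn.2.1 hp
    refine ⟨⟨hn.of_cons.of_cons, fun p hp => ?_⟩, hne⟩
    obtain ⟨h1, h2⟩ := h p (by simp [hp])
    refine ⟨?_, fun q hq => h2 q (by simp [hq])⟩
    have := hne p hp
    simpa [this] using h1
  · rintro ⟨⟨hn, h⟩, hne⟩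
    refine ⟨?_, ?_⟩
    · simp only [List.nodup_cons, List.mem_cons, not_or]
      refine ⟨⟨by simp, fun hp => hne _ hp rfl⟩, fun hp => hne _ hp rfl, hn⟩
    · intro p hp
      simp only [List.mem_cons] at hp ⊢
      rcases hp with rfl | rfl | hp
      · refine ⟨by simp, ?_⟩
        rintro q (rfl | rfl | hq) hc
        · rfl
        · rfl
        · exact absurd hc (hne q hq)
      · refine ⟨by simp, ?_⟩
        rintro q (rfl | rfl | hq) hc
        · rfl
        · rfl
        · exact absurd hc (hne q hq)
      · refine ⟨Or.inr (Or.inr (h p hp).1), ?_⟩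
        rintro q (rfl | rfl | hq) hc
        · exact absurd hc.symm (hne p hp)
        · exact absurd hc.symm (hne p hp)
        · exact (h p hp).2 q hq hc

theorem IsGaussCode.flipSign {w : List Passage} (hw : IsGaussCode w) (c : ℕ) :
    IsGaussCode (flipSign c w) := by
  unfold _root_.flipSign
  refine ⟨hw.1.map ?_, ?_⟩
  · rintro ⟨pc, po, ps⟩ ⟨qc, qo, qs⟩ h
    dsimp only at h
    split_ifs at h <;> simp_all
  · intro p hp
    obtain ⟨p₀, hp₀, rfl⟩ := List.mem_map.1 hp
    obtain ⟨h1, h2⟩ := hw.2 p₀ hp₀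
    refine ⟨List.mem_map.2 ⟨_, h1, ?_⟩, ?_⟩
    · split_ifs <;> rfl
    · intro q hq hc
      obtain ⟨q₀, hq₀, rfl⟩ := List.mem_map.1 hq
      have hc₀ : q₀.crossing = p₀.crossing := by
        split_ifs at hc <;> simpa using hc
      have := h2 q₀ hq₀ hc₀
      rw [hc₀]
      split_ifs <;> simp [this]

theorem flipSign_append (c : ℕ) (u v : List Passage) :
    flipSign c (u ++ v) = flipSign c u ++ flipSign c v := List.map_append

theorem flipSign_eq_self {c : ℕ} {w : List Passage} (h : ∀ p ∈ w, p.crossing ≠ c) :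
    flipSign c w = w := by
  unfold flipSign
  conv_rhs => rw [← List.map_id w]
  exact List.map_congr_left fun p hp => by simp [h p hp]

theorem flipSign_flipSign (c : ℕ) (w : List Passage) : flipSign c (flipSign c w) = w := by
  unfold flipSign
  rw [List.map_map]
  conv_rhs => rw [← List.map_id w]
  refine List.map_congr_left fun p _ => ?_
  by_cases h : p.crossing = c <;> simp [h, Passage.ext_iff]

/-! ### Arc shift moves and distance -/

theorem ArcShiftMove.symm {D D' : GaussCode} (h : ArcShiftMove D D') : ArcShiftMove D' D := by
  cases h with
  | classical p q u v hne hD hD' =>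
    let f := fun w => flipSign p.crossing (flipSign q.crossing w)
    refine .classical D' D ⟨q.crossing, q.isOver, -q.sign⟩ ⟨p.crossing, p.isOver, -p.sign⟩
      (f u) (f v) hne.symm ?_ ?_
    · rw [hD']
      simp only [flipSign_append, f]
      congr 2
      simp [flipSign, hne, hne.symm]
    · rw [hD]
      simp only [flipSign_append, flipSign_flipSign, f]
      congr 2
      simp [flipSign, hne, hne.symm]
  | mixed c hc hD' =>
    refine .mixed D' D c ?_ (by rw [hD', flipSign_flipSign])
    obtain ⟨p, hp, rfl⟩ := hc
    rw [hD']
    exact ⟨_, List.mem_map.2 ⟨p, hp, rfl⟩, by simp⟩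

theorem ArcShiftAdjacent.symm {K L : VirtualKnot} (h : ArcShiftAdjacent K L) :
    ArcShiftAdjacent L K := by
  obtain ⟨D, D', hD, hD', hm⟩ := h
  exact ⟨D', D, hD', hD, hm.symm⟩

theorem arcShiftDist_eq_one {K L : VirtualKnot} (hne : K ≠ L) (h : ArcShiftAdjacent K L) :
    arcShiftDist K L = 1 := by
  refine le_antisymm (sInf_le ⟨1, rfl, K, rfl, h⟩) (le_sInf ?_)
  rintro _ ⟨n, rfl, hn⟩
  rcases n with _ | n
  · exact absurd hn hne
  · exact_mod_cast Nat.succ_le_succ (Nat.zero_le n)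

/-! ### Cancelling pairs of crossings -/

theorem inOrder_perm (ε : ℤˣ) (p q : Passage) : (inOrder ε p q).Perm [p, q] := by
  unfold inOrder
  split_ifs
  · exact .refl _
  · exact .swap _ _ _

theorem kink_perm (p q : Passage) (u v : List Passage) :
    (u ++ [p, q] ++ v).Perm (p :: q :: (u ++ v)) := by
  classical
  rw [List.perm_iff_count]
  intro a
  simp only [List.count_append, List.count_cons, List.count_nil]
  ring

theorem r2_perm (p p' q q' : Passage) (ε : ℤˣ) (u v w : List Passage) :
    (u ++ [p, q] ++ v ++ inOrder ε p' q' ++ w).Perm (p :: p' :: q :: q' :: (u ++ v ++ w)) := by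
  classical
  rw [List.perm_iff_count]
  intro a
  simp only [List.count_append, List.count_cons, (inOrder_perm ε p' q').count_eq, List.count_nil]
  ring

/-- The two crossings of a second Reidemeister move can be deleted from any Gauss code. -/
theorem exists_mk_eq_of_r2 (a b : ℕ) (o : Bool) (s ε : ℤˣ) (u v w : List Passage)
    (h : IsGaussCode
      (u ++ [⟨a, o, s⟩, ⟨b, o, -s⟩] ++ v ++ inOrder ε ⟨a, !o, s⟩ ⟨b, !o, -s⟩ ++ w)) :
    ∃ h' : IsGaussCode (u ++ v ++ w),
      Quotient.mk virtualKnotSetoid ⟨_, h⟩ = Quotient.mk virtualKnotSetoid ⟨_, h'⟩ := by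
  have h1 := h.perm (r2_perm _ _ _ _ _ _ _ _)
  have h' := (isGaussCode_cons_cons_iff.1 (isGaussCode_cons_cons_iff.1 h1).1).1
  exact ⟨h', (Quotient.sound (Relation.EqvGen.rel _ _ (.r2 a b o s ε u v w))).symm⟩

/-! ### Colourings of Gauss codes -/

section Colouring

variable {R : Type*} [CommRing R]

/-- The coefficient `t ^ s` by which an under-passage of sign `s` acts. -/
def signPow (t : Rˣ) (s : ℤˣ) : R := ((t ^ (s : ℤ) : Rˣ) : R)

@[simp] theorem signPow_one (t : Rˣ) : signPow t 1 = t := by simp [signPow]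

@[simp] theorem signPow_neg_one (t : Rˣ) : signPow t (-1) = (t⁻¹ : Rˣ) := by simp [signPow]

theorem signPow_mul_neg (t : Rˣ) (s : ℤˣ) : signPow t s * signPow t (-s) = 1 := by
  rcases Int.units_eq_one_or s with rfl | rfl <;> simp

theorem signPow_inv (t : Rˣ) (s : ℤˣ) : signPow t⁻¹ s = signPow t (-s) := by
  rcases Int.units_eq_one_or s with rfl | rfl <;> simp

/-- `Transports t k x w y`: walking along `w`, a strand that enters with colour `x` leaves with
colour `y`, where `k c` is the colour with which the upper strand enters the crossing `c`. An
over-passage negates the colour, and an under-passage at `c` of sign `s` changes `x` to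
`t ^ s * x + (1 + t ^ s) * k c`. -/
def Transports (t : Rˣ) (k : ℕ → R) : R → List Passage → R → Prop
  | x, [], y => x = y
  | x, p :: w, y =>
    if p.isOver then k p.crossing = x ∧ Transports t k (-x) w y
    else Transports t k (signPow t p.sign * x + (1 + signPow t p.sign) * k p.crossing) w y

variable {t : Rˣ} {k k' : ℕ → R} {x y : R}

@[simp] theorem transports_nil : Transports t k x [] y ↔ x = y := Iff.rfl

@[simp] theorem transports_over {c : ℕ} {s : ℤˣ} {w : List Passage} :
    Transports t k x (⟨c, true, s⟩ :: w) y ↔ k c = x ∧ Transports t k (-x) w y := by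
  simp [Transports]

@[simp] theorem transports_under {c : ℕ} {s : ℤˣ} {w : List Passage} :
    Transports t k x (⟨c, false, s⟩ :: w) y ↔
      Transports t k (signPow t s * x + (1 + signPow t s) * k c) w y := by
  simp [Transports]

theorem transports_append {u v : List Passage} :
    Transports t k x (u ++ v) y ↔ ∃ z, Transports t k x u z ∧ Transports t k z v y := by
  induction u generalizing x with
  | nil => simp
  | cons p u ih =>
    obtain ⟨c, o, s⟩ := p
    cases o <;> simp [ih, and_assoc]

theorem transports_congr {w : List Passage} (h : ∀ p ∈ w, k p.crossing = k' p.crossing) :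
    Transports t k x w y ↔ Transports t k' x w y := by
  induction w generalizing x with
  | nil => simp
  | cons p w ih =>
    obtain ⟨c, o, s⟩ := p
    have hc : k c = k' c := h ⟨c, o, s⟩ (by simp)
    have ih' : ∀ {x}, _ := fun {x} => ih (x := x) fun p hp => h p (by simp [hp])
    cases o <;> simp [ih', hc]

/-- Colours annihilated by `r` stay so along a strand. -/
theorem Transports.mul_eq_zero {r : R} {w : List Passage} (h : Transports t k x w y)
    (hx : r * x = 0) (hk : ∀ p ∈ w, r * k p.crossing = 0) : r * y = 0 := by
  induction w generalizing x with
  | nil => rwa [← transports_nil.1 h]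
  | cons p w ih =>
    obtain ⟨c, o, s⟩ := p
    have hc : r * k c = 0 := hk ⟨c, o, s⟩ (by simp)
    have ih' := fun {x} h hx => ih (x := x) h hx fun p hp => hk p (by simp [hp])
    cases o
    · refine ih' (transports_under.1 h) ?_
      linear_combination signPow t s * hx + (1 + signPow t s) * hc
    · refine ih' (transports_over.1 h).2 ?_
      linear_combination -hx

/-- Walking backwards, the upper strand enters a crossing with the negative of its colour, and under
strands are acted on by the inverse parameter. -/
theorem Transports.reverse {w : List Passage} (h : Transports t k x w y) :
    Transports t⁻¹ (fun c => -k c) y w.reverse x := by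
  induction w generalizing x with
  | nil => exact (transports_nil.1 h).symm
  | cons p w ih =>
    obtain ⟨c, o, s⟩ := p
    rw [List.reverse_cons, transports_append]
    cases o
    · refine ⟨_, ih (transports_under.1 h), ?_⟩
      rw [transports_under, transports_nil, signPow_inv]
      linear_combination (x + k c) * signPow_mul_neg t s
    · obtain ⟨h1, h2⟩ := transports_over.1 h
      refine ⟨_, ih h2, ?_⟩
      simp [h1]

theorem transports_rename (σ : Equiv.Perm ℕ) {w : List Passage} :
    Transports t k x (w.map fun p => ⟨σ p.crossing, p.isOver, p.sign⟩) y ↔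
      Transports t (k ∘ σ) x w y := by
  induction w generalizing x with
  | nil => simp
  | cons p w ih =>
    obtain ⟨c, o, s⟩ := p
    cases o <;> simp [ih]

theorem transports_kink {c : ℕ} {o : Bool} {s : ℤˣ} :
    Transports t k x [⟨c, o, s⟩, ⟨c, !o, s⟩] y ↔ k c = (if o then x else -x) ∧ x = y := by
  have hu := signPow_mul_neg t s
  cases o
  · simp only [Bool.not_false, transports_under, transports_over, transports_nil, Bool.false_eq_true,
      if_false]
    constructor
    · rintro ⟨h1, h2⟩
      have : k c = -x := by linear_combination (-signPow t (-s)) * h1 - (x + k c) * hu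
      exact ⟨this, by rw [← h2, this]; ring⟩
    · rintro ⟨h1, rfl⟩
      rw [h1]
      constructor <;> ring
  · simp only [Bool.not_true, transports_under, transports_over, transports_nil, if_true]
    refine and_congr_right fun h => ?_
    rw [h]
    constructor <;> rintro rfl <;> ring

theorem transports_inOrder_over {a b : ℕ} {s s' ε : ℤˣ} :
    Transports t k x (inOrder ε ⟨a, true, s⟩ ⟨b, true, s'⟩) y ↔
      k a = ((ε : ℤ) : R) * x ∧ k b = -(((ε : ℤ) : R) * x) ∧ x = y := by
  rcases Int.units_eq_one_or ε with rfl | rfl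
  · simp [inOrder]
  · simp [inOrder]
    tauto

theorem transports_inOrder_under {a b : ℕ} {s ε : ℤˣ} (h : k b = -k a) :
    Transports t k x (inOrder ε ⟨a, false, s⟩ ⟨b, false, -s⟩) y ↔ x = y := by
  have hu := signPow_mul_neg t s
  have key : ∀ z : R, z = x → (z = y ↔ x = y) := by rintro _ rfl; rfl
  rcases Int.units_eq_one_or ε with rfl | rfl
  · change Transports t k x [_, _] y ↔ _
    rw [transports_under, transports_under, transports_nil]
    apply key
    rw [h]
    linear_combination (x + k a) * hu
  · change Transports t k x [_, _] y ↔ _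
    rw [transports_under, transports_under, transports_nil]
    apply key
    rw [h]
    linear_combination (x - k a) * hu

/-! ### Invariance of colourability -/

/-- There is a colouring of the closed code `w` with parameter `t` that is not annihilated by `r`. -/
def Colourable (t : Rˣ) (r : R) (w : List Passage) : Prop :=
  ∃ (k : ℕ → R) (x : R), Transports t k x w x ∧ (r * x = 0 → ∃ p ∈ w, r * k p.crossing ≠ 0)

variable {r : R}

theorem Colourable.rotate {u v : List Passage} (h : Colourable t r (u ++ v)) :
    Colourable t r (v ++ u) := by
  obtain ⟨k, x, h, hr⟩ := h
  obtain ⟨z, h1, h2⟩ := transports_append.1 h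
  refine ⟨k, z, transports_append.2 ⟨x, h2, h1⟩, fun hz => ?_⟩
  by_contra! hk
  obtain ⟨p, hp, hp'⟩ := hr (h2.mul_eq_zero hz fun p hp => hk p (by simp [hp]))
  exact hp' (hk p (by simpa [or_comm] using hp))

theorem Colourable.reverse {w : List Passage} (h : Colourable t r w) :
    Colourable t⁻¹ r w.reverse := by
  obtain ⟨k, x, h, hr⟩ := h
  refine ⟨_, x, h.reverse, fun hx => ?_⟩
  obtain ⟨p, hp, hp'⟩ := hr hx
  exact ⟨p, by simpa using hp, by simpa using hp'⟩

theorem colourable_rename_iff (σ : Equiv.Perm ℕ) {w : List Passage} :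
    Colourable t r (w.map fun p => ⟨σ p.crossing, p.isOver, p.sign⟩) ↔ Colourable t r w := by
  constructor
  · rintro ⟨k, x, h, hr⟩
    refine ⟨k ∘ σ, x, (transports_rename σ).1 h, fun hx => ?_⟩
    obtain ⟨p, hp, hp'⟩ := hr hx
    obtain ⟨q, hq, rfl⟩ := List.mem_map.1 hp
    exact ⟨q, hq, hp'⟩
  · rintro ⟨k, x, h, hr⟩
    refine ⟨k ∘ σ.symm, x, (transports_rename σ).2 ?_, fun hx => ?_⟩
    · rwa [Function.comp_assoc, Equiv.symm_comp_self, Function.comp_id]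
    · obtain ⟨p, hp, hp'⟩ := hr hx
      exact ⟨_, List.mem_map.2 ⟨p, hp, rfl⟩, by simpa using hp'⟩

theorem transports_update {c : ℕ} {a : R} {w : List Passage} (h : ∀ p ∈ w, p.crossing ≠ c) :
    Transports t (Function.update k c a) x w y ↔ Transports t k x w y :=
  transports_congr fun p hp => Function.update_of_ne (h p hp) _ _

theorem colourable_r1_iff {c : ℕ} {o : Bool} {s : ℤˣ} {u v : List Passage}
    (hw : IsGaussCode (u ++ [⟨c, o, s⟩, ⟨c, !o, s⟩] ++ v)) :
    Colourable t r (u ++ [⟨c, o, s⟩, ⟨c, !o, s⟩] ++ v) ↔ Colourable t r (u ++ v) := by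
  have hc := (isGaussCode_cons_cons_iff.1 (hw.perm (kink_perm _ _ _ _))).2
  have hu : ∀ p ∈ u, p.crossing ≠ c := fun p hp => hc p (by simp [hp])
  have hv : ∀ p ∈ v, p.crossing ≠ c := fun p hp => hc p (by simp [hp])
  constructor
  · rintro ⟨k, x, h, hr⟩
    simp only [transports_append, transports_kink] at h
    obtain ⟨z, ⟨y, h1, hk, rfl⟩, h2⟩ := h
    refine ⟨k, x, transports_append.2 ⟨_, h1, h2⟩, fun hx => ?_⟩
    by_contra! h0
    have hy := h1.mul_eq_zero hx fun p hp => h0 p (by simp [hp])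
    obtain ⟨p, hp, hp'⟩ := hr hx
    have hkc : r * k c = 0 := by rw [hk]; split_ifs <;> simp [hy]
    simp only [List.mem_append, List.mem_cons, List.not_mem_nil, or_false] at hp
    rcases hp with (hp | rfl | rfl) | hp
    · exact hp' (h0 p (by simp [hp]))
    · exact hp' hkc
    · exact hp' hkc
    · exact hp' (h0 p (by simp [hp]))
  · rintro ⟨k, x, h, hr⟩
    obtain ⟨y, h1, h2⟩ := transports_append.1 h
    refine ⟨Function.update k c (if o then y else -y), x, ?_, fun hx => ?_⟩
    · simp only [transports_append, transports_kink]
      exact ⟨y, ⟨y, (transports_update hu).2 h1, by simp, rfl⟩, (transports_update hv).2 h2⟩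
    · obtain ⟨p, hp, hp'⟩ := hr hx
      refine ⟨p, ?_, by rwa [Function.update_of_ne (hc p hp)]⟩
      simp only [List.mem_append] at hp ⊢
      tauto

theorem colourable_r2_iff {a b : ℕ} {o : Bool} {s ε : ℤˣ} {u v w : List Passage}
    (hw : IsGaussCode
      (u ++ [⟨a, o, s⟩, ⟨b, o, -s⟩] ++ v ++ inOrder ε ⟨a, !o, s⟩ ⟨b, !o, -s⟩ ++ w)) :
    Colourable t r
        (u ++ [⟨a, o, s⟩, ⟨b, o, -s⟩] ++ v ++ inOrder ε ⟨a, !o, s⟩ ⟨b, !o, -s⟩ ++ w) ↔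
      Colourable t r (u ++ v ++ w) := by
  obtain ⟨hw', ha⟩ := isGaussCode_cons_cons_iff.1 (hw.perm (r2_perm _ _ _ _ _ _ _ _))
  have hb := (isGaussCode_cons_cons_iff.1 hw').2
  have hba : b ≠ a := ha ⟨b, o, -s⟩ (by simp)
  replace ha : ∀ p ∈ u ++ v ++ w, p.crossing ≠ a := fun p hp => ha p (by simp [-List.append_assoc, hp])
  -- the colours of the upper strand at the two crossings, given those of the strands before the move
  have key : ∀ (k : ℕ → R) (y z y' z' : R),
      Transports t k y [⟨a, o, s⟩, ⟨b, o, -s⟩] y' ∧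
        Transports t k z (inOrder ε ⟨a, !o, s⟩ ⟨b, !o, -s⟩) z' ↔
      (k a = (if o then y else ((ε : ℤ) : R) * z) ∧ k b = -k a) ∧ y = y' ∧ z = z' := by
    intro k y z y' z'
    have h1 : ∀ o, [(⟨a, o, s⟩ : Passage), ⟨b, o, -s⟩] = inOrder 1 ⟨a, o, s⟩ ⟨b, o, -s⟩ :=
      fun o => by simp [inOrder]
    rw [h1]
    cases o
    · simp only [Bool.not_false, transports_inOrder_over, Bool.false_eq_true, if_false]
      constructor
      · rintro ⟨h1, h2, h3, h4⟩
        have h5 : k b = -k a := by rw [h2, h3]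
        exact ⟨⟨h2, h5⟩, (transports_inOrder_under h5).1 h1, h4⟩
      · rintro ⟨⟨h2, h5⟩, h1, h4⟩
        exact ⟨(transports_inOrder_under h5).2 h1, h2, by rw [h5, h2], h4⟩
    · simp only [Bool.not_true, transports_inOrder_over, if_true, Units.val_one, Int.cast_one, one_mul]
      constructor
      · rintro ⟨⟨h2, h3, h4⟩, h1⟩
        have h5 : k b = -k a := by rw [h2, h3]
        exact ⟨⟨h2, h5⟩, h4, (transports_inOrder_under h5).1 h1⟩
      · rintro ⟨⟨h2, h5⟩, h4, h1⟩
        exact ⟨⟨h2, by rw [h5, h2], h4⟩, (transports_inOrder_under h5).2 h1⟩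
  constructor
  · rintro ⟨k, x, h, hr⟩
    simp only [transports_append] at h
    obtain ⟨z', ⟨z, ⟨y', ⟨y, h1, h2⟩, h3⟩, h4⟩, h5⟩ := h
    obtain ⟨⟨hka, hkb⟩, rfl, rfl⟩ := (key _ _ _ _ _).1 ⟨h2, h4⟩
    refine ⟨k, x, ?_, fun hx => ?_⟩
    · simp only [transports_append]
      exact ⟨_, ⟨_, h1, h3⟩, h5⟩
    by_contra! h0
    have hy := h1.mul_eq_zero hx fun p hp => h0 p (by simp [hp])
    have hz := h3.mul_eq_zero hy fun p hp => h0 p (by simp [hp])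
    have hra : r * k a = 0 := by
      rw [hka]
      split_ifs
      · exact hy
      · linear_combination ((ε : ℤ) : R) * hz
    have hrb : r * k b = 0 := by rw [hkb]; linear_combination -hra
    obtain ⟨p, hp, hp'⟩ := hr hx
    simp only [List.mem_append, (inOrder_perm _ _ _).mem_iff, List.mem_cons, List.not_mem_nil,
      or_false] at hp
    rcases hp with (((hp | rfl | rfl) | hp) | rfl | rfl) | hp
    all_goals first
      | exact hp' hra
      | exact hp' hrb
      | exact hp' (h0 p (by simp [hp]))
  · rintro ⟨k, x, h, hr⟩
    simp only [transports_append] at h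
    obtain ⟨z, ⟨y, h1, h3⟩, h5⟩ := h
    obtain ⟨e, he⟩ : ∃ e, e = if o then y else ((ε : ℤ) : R) * z := ⟨_, rfl⟩
    have hk : ∀ p ∈ u ++ v ++ w,
        k p.crossing = Function.update (Function.update k a e) b (-e) p.crossing := fun p hp => by
      rw [Function.update_of_ne (hb p hp), Function.update_of_ne (ha p hp)]
    obtain ⟨h2, h4⟩ := (key (Function.update (Function.update k a e) b (-e)) y z y z).2
      ⟨⟨by simp [hba.symm, he], by simp [hba.symm]⟩, rfl, rfl⟩
    refine ⟨Function.update (Function.update k a e) b (-e), x, ?_, fun hx => ?_⟩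
    · simp only [transports_append]
      exact ⟨z, ⟨z, ⟨y, ⟨y, (transports_congr fun p hp => hk p (by simp [hp])).1 h1, h2⟩,
        (transports_congr fun p hp => hk p (by simp [hp])).1 h3⟩, h4⟩,
        (transports_congr fun p hp => hk p (by simp [hp])).1 h5⟩
    · obtain ⟨p, hp, hp'⟩ := hr hx
      refine ⟨p, ?_, by rwa [← hk p hp]⟩
      simp only [List.mem_append] at hp ⊢
      tauto


end Colouring

/-! ### The third Reidemeister move -/

section Colouring

variable {R : Type*} [CommRing R] {t : Rˣ} {k k' : ℕ → R} {r : R}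

theorem transports_middleStrand {x z : ℕ} {sx sz β : ℤˣ} {b b' : R} :
    Transports t k b (middleStrand x z sx sz β) b' ↔
      b' = -(signPow t sx * b + ((β : ℤ) : R) * (1 + signPow t sx) * k x) ∧
        k z = if β = 1 then -b' else b := by
  rcases Int.units_eq_one_or β with rfl | rfl
  · change Transports t k b [_, _] b' ↔ _
    rw [transports_under, transports_over, transports_nil]
    simp only [Units.val_one, Int.cast_one, one_mul, if_true]
    constructor
    · rintro ⟨h1, h2⟩
      exact ⟨h2.symm, by rw [h1, ← h2, neg_neg]⟩
    · rintro ⟨h1, h2⟩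
      exact ⟨by rw [h2, h1, neg_neg], h1.symm⟩
  · change Transports t k b [_, _] b' ↔ _
    rw [transports_over, transports_under, transports_nil, if_neg (by decide)]
    simp only [Units.val_neg, Units.val_one, Int.cast_neg, Int.cast_one]
    constructor
    · rintro ⟨h1, h2⟩
      exact ⟨by rw [← h2]; ring, h1⟩
    · rintro ⟨h1, h2⟩
      exact ⟨h2, by rw [h1]; ring⟩

theorem transports_bottomStrand {y z : ℕ} {sy sz γ : ℤˣ} {c c' : R} :
    Transports t k c (bottomStrand y z sy sz γ) c' ↔
      c' = signPow t sy * signPow t sz * c +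
        (if γ = 1 then
          signPow t sz * (1 + signPow t sy) * k y + (1 + signPow t sz) * k z
        else signPow t sy * (1 + signPow t sz) * k z + (1 + signPow t sy) * k y) := by
  rcases Int.units_eq_one_or γ with rfl | rfl
  · change Transports t k c [_, _] c' ↔ _
    rw [transports_under, transports_under, transports_nil, if_pos rfl, eq_comm]
    ring_nf
  · change Transports t k c [_, _] c' ↔ _
    rw [transports_under, transports_under, transports_nil, if_neg (by decide), eq_comm]
    ring_nf

/-- The colours at the six ends of a triangle do not change in a third Reidemeister move, if the
colours `k x`, `k y` of the top strand at its crossings are negated and `k z` is adapted to the new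
order on the middle strand. -/
theorem transports_triangle {x y z : ℕ} {sx sy sz α β γ : ℤˣ}
    (hxz : α * sx = γ * sz) (hxy : β * sx = γ * sy) {a a' b b' c c' : R}
    (h1 : Transports t k a (topStrand x y sx sy α) a')
    (h2 : Transports t k b (middleStrand x z sx sz β) b')
    (h3 : Transports t k c (bottomStrand y z sy sz γ) c')
    (hx : k' x = -k x) (hy : k' y = -k y) (hz : k' z = if β = 1 then b else -b') :
    Transports t k' a (topStrand x y sx sy (-α)) a' ∧
      Transports t k' b (middleStrand x z sx sz (-β)) b' ∧
        Transports t k' c (bottomStrand y z sy sz (-γ)) c' := by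
  unfold topStrand at *
  rw [transports_inOrder_over] at h1 ⊢
  rw [transports_middleStrand] at h2 ⊢
  rw [transports_bottomStrand] at h3 ⊢
  rw [hx, hy, hz]
  obtain ⟨h1x, h1y, rfl⟩ := h1
  obtain ⟨h2, h2z⟩ := h2
  refine ⟨⟨by rw [h1x]; simp, by rw [h1y]; simp, rfl⟩, ⟨?_, ?_⟩, ?_⟩
  · rw [h2]
    push_cast
    ring
  · rcases Int.units_eq_one_or β with rfl | rfl <;> simp
  · rw [h3, h2z, h1y, h2, h1x]
    have hu : (t : R) * ((t⁻¹ : Rˣ) : R) = 1 := by simp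
    have hsz : sz = α * γ * sx := by
      rw [mul_comm α γ, mul_assoc, hxz, ← mul_assoc, Int.units_mul_self, one_mul]
    have hsy : sy = β * γ * sx := by
      rw [mul_comm β γ, mul_assoc, hxy, ← mul_assoc, Int.units_mul_self, one_mul]
    subst hsz hsy
    clear hx hy hz h2 h2z h1x h1y h3 hxz hxy
    rcases Int.units_eq_one_or α with rfl | rfl <;> rcases Int.units_eq_one_or β with rfl | rfl <;>
      rcases Int.units_eq_one_or γ with rfl | rfl <;> rcases Int.units_eq_one_or sx with rfl | rfl
    all_goals
      simp only [neg_mul, one_mul, mul_one, neg_neg, mul_neg, signPow_one, signPow_neg_one,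
        Units.val_one, Units.val_neg, Int.cast_one, Int.cast_neg, if_true,
        show ((-1 : ℤˣ) = 1) = False by decide, if_false]
    all_goals generalize ((t⁻¹ : Rˣ) : R) = t' at hu ⊢
    all_goals grind

/-- Replacing three pieces of a code by pieces through the same three crossings preserves
colourability, if colourings of the pieces can be replaced without changing the colours at their
ends and without becoming annihilated by `r`. -/
theorem Colourable.of_replace {x y z : ℕ} {A B C A' B' C' u v w : List Passage}
    (hfresh : ∀ p ∈ u ++ v ++ w, p.crossing ≠ x ∧ p.crossing ≠ y ∧ p.crossing ≠ z)
    (hmem : ∀ p ∈ A ++ B ++ C, p.crossing = x ∨ p.crossing = y ∨ p.crossing = z)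
    (hmem' : ∀ c, c = x ∨ c = y ∨ c = z → ∃ p ∈ A' ++ B' ++ C', p.crossing = c)
    (H : ∀ (k : ℕ → R) (a a' b b' c c' : R), Transports t k a A a' → Transports t k b B b' →
      Transports t k c C c' → ∃ k' : ℕ → R, (∀ d, d ≠ x ∧ d ≠ y ∧ d ≠ z → k' d = k d) ∧
        Transports t k' a A' a' ∧ Transports t k' b B' b' ∧ Transports t k' c C' c' ∧
        (r * a = 0 → r * b = 0 → r * c = 0 → r * k' x = 0 → r * k' y = 0 → r * k' z = 0 →
          r * k x = 0 ∧ r * k y = 0 ∧ r * k z = 0))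
    (h : Colourable t r (A ++ u ++ B ++ v ++ C ++ w)) :
    Colourable t r (A' ++ u ++ B' ++ v ++ C' ++ w) := by
  obtain ⟨k, a, h, hr⟩ := h
  simp only [transports_append] at h
  obtain ⟨c', ⟨c, ⟨b', ⟨b, ⟨a', hA, hu⟩, hB⟩, hv⟩, hC⟩, hw⟩ := h
  obtain ⟨k', hk, hA', hB', hC', hr'⟩ := H k a a' b b' c c' hA hB hC
  have hk' : ∀ p ∈ u ++ v ++ w, k p.crossing = k' p.crossing := fun p hp =>
    (hk _ (hfresh p hp)).symm
  have hu' := (transports_congr fun p hp => hk' p (by simp [hp])).1 hu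
  have hv' := (transports_congr fun p hp => hk' p (by simp [hp])).1 hv
  have hw' := (transports_congr fun p hp => hk' p (by simp [hp])).1 hw
  refine ⟨k', a, ?_, fun ha => ?_⟩
  · simp only [transports_append]
    exact ⟨_, ⟨_, ⟨_, ⟨_, ⟨_, hA', hu'⟩, hB'⟩, hv'⟩, hC'⟩, hw'⟩
  by_contra! h0
  have ha' := hA'.mul_eq_zero ha fun p hp => h0 p (by simp [hp])
  have hb := hu'.mul_eq_zero ha' fun p hp => h0 p (by simp [hp])
  have hb' := hB'.mul_eq_zero hb fun p hp => h0 p (by simp [hp])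
  have hc := hv'.mul_eq_zero hb' fun p hp => h0 p (by simp [hp])
  have h0' : ∀ d, d = x ∨ d = y ∨ d = z → r * k' d = 0 := fun d hd => by
    obtain ⟨p, hp, rfl⟩ := hmem' d hd
    refine h0 p ?_
    simp only [List.mem_append] at hp ⊢
    tauto
  obtain ⟨hx, hy, hz⟩ := hr' ha hb hc (h0' x (by simp)) (h0' y (by simp)) (h0' z (by simp))
  obtain ⟨p, hp, hp'⟩ := hr ha
  have hp'' : p ∈ A ++ B ++ C ∨ p ∈ u ++ v ++ w := by
    simp only [List.mem_append] at hp ⊢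
    tauto
  rcases hp'' with hp'' | hp''
  · rcases hmem p hp'' with h | h | h <;> rw [h] at hp'
    exacts [hp' hx, hp' hy, hp' hz]
  · rw [hk' p hp''] at hp'
    refine hp' (h0 p ?_)
    simp only [List.mem_append] at hp'' ⊢
    tauto

theorem r3_perm {A B C : List Passage} {p p' q q' s s' : Passage} (hA : A.Perm [p, q])
    (hB : B.Perm [p', s]) (hC : C.Perm [q', s']) (u v w : List Passage) :
    (A ++ u ++ B ++ v ++ C ++ w).Perm
      (p :: p' :: q :: q' :: s :: s' :: (u ++ v ++ w)) := by
  classical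
  rw [List.perm_iff_count]
  intro a
  simp only [List.count_append, List.count_cons, hA.count_eq, hB.count_eq, hC.count_eq,
    List.count_nil]
  ring

/-- The three crossings of a triangle are distinct and occur nowhere else in the code. -/
theorem IsGaussCode.triangle_ne {x y z : ℕ} {sx sy sz : ℤˣ} {w : List Passage}
    (h : IsGaussCode (⟨x, true, sx⟩ :: ⟨x, false, sx⟩ :: ⟨y, true, sy⟩ :: ⟨y, false, sy⟩ ::
      ⟨z, true, sz⟩ :: ⟨z, false, sz⟩ :: w)) :
    (y ≠ x ∧ z ≠ x ∧ z ≠ y) ∧ ∀ p ∈ w, p.crossing ≠ x ∧ p.crossing ≠ y ∧ p.crossing ≠ z := by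
  obtain ⟨h, hx⟩ := isGaussCode_cons_cons_iff (o := true).1 h
  obtain ⟨h, hy⟩ := isGaussCode_cons_cons_iff (o := true).1 h
  obtain ⟨h, hz⟩ := isGaussCode_cons_cons_iff (o := true).1 h
  exact ⟨⟨hx ⟨y, true, sy⟩ (by simp), hx ⟨z, true, sz⟩ (by simp), hy ⟨z, true, sz⟩ (by simp)⟩,
    fun p hp => ⟨hx p (by simp [hp]), hy p (by simp [hp]), hz p hp⟩⟩

theorem exists_transports_triangle {x y z : ℕ} {sx sy sz α β γ : ℤˣ}
    (hne : y ≠ x ∧ z ≠ x ∧ z ≠ y) (hxz : α * sx = γ * sz) (hxy : β * sx = γ * sy)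
    {a a' b b' c c' : R} (h1 : Transports t k a (topStrand x y sx sy α) a')
    (h2 : Transports t k b (middleStrand x z sx sz β) b')
    (h3 : Transports t k c (bottomStrand y z sy sz γ) c') :
    ∃ k' : ℕ → R, (∀ d, d ≠ x ∧ d ≠ y ∧ d ≠ z → k' d = k d) ∧
      Transports t k' a (topStrand x y sx sy (-α)) a' ∧
      Transports t k' b (middleStrand x z sx sz (-β)) b' ∧
      Transports t k' c (bottomStrand y z sy sz (-γ)) c' ∧
      (r * b = 0 → r * k' x = 0 → r * k' y = 0 →
        r * k x = 0 ∧ r * k y = 0 ∧ r * k z = 0) := by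
  obtain ⟨hyx, hzx, hzy⟩ := hne
  obtain ⟨k', hx, hy, hz, hk⟩ : ∃ k' : ℕ → R, k' x = -k x ∧ k' y = -k y ∧
      (k' z = if β = 1 then b else -b') ∧ ∀ d, d ≠ x ∧ d ≠ y ∧ d ≠ z → k' d = k d :=
    ⟨Function.update (Function.update (Function.update k x (-k x)) y (-k y)) z
      (if β = 1 then b else -b'), by simp [hyx.symm, hzx.symm], by simp [hzy.symm], by simp,
      fun d hd => by simp [hd]⟩
  obtain ⟨h1', h2', h3'⟩ := transports_triangle hxz hxy h1 h2 h3 hx hy hz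
  refine ⟨k', hk, h1', h2', h3', fun hb h0x h0y => ?_⟩
  rw [transports_middleStrand] at h2
  have hkx : r * k x = 0 := by rw [hx] at h0x; linear_combination -h0x
  have hky : r * k y = 0 := by rw [hy] at h0y; linear_combination -h0y
  refine ⟨hkx, hky, ?_⟩
  rw [h2.2]
  split_ifs
  · rw [h2.1]
    linear_combination signPow t sx * hb + ((β : ℤ) : R) * (1 + signPow t sx) * hkx
  · exact hb

theorem mem_inOrder_iff {x y : ℕ} {o o' : Bool} {s s' ε : ℤˣ} {p : Passage} :
    p ∈ inOrder ε ⟨x, o, s⟩ ⟨y, o', s'⟩ ↔ p = ⟨x, o, s⟩ ∨ p = ⟨y, o', s'⟩ := by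
  rw [(inOrder_perm _ _ _).mem_iff]
  simp

theorem Colourable.r3 {x y z : ℕ} {sx sy sz α β γ : ℤˣ} (hxz : α * sx = γ * sz)
    (hxy : β * sx = γ * sy) {u v w : List Passage}
    (hw : IsGaussCode (topStrand x y sx sy α ++ u ++ middleStrand x z sx sz β ++ v ++
      bottomStrand y z sy sz γ ++ w))
    (h : Colourable t r (topStrand x y sx sy α ++ u ++ middleStrand x z sx sz β ++ v ++
      bottomStrand y z sy sz γ ++ w)) :
    Colourable t r (topStrand x y sx sy (-α) ++ u ++ middleStrand x z sx sz (-β) ++ v ++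
      bottomStrand y z sy sz (-γ) ++ w) := by
  obtain ⟨hne, hfresh⟩ := (hw.perm (r3_perm (inOrder_perm _ _ _) (inOrder_perm _ _ _)
    (inOrder_perm _ _ _) _ _ _)).triangle_ne
  refine h.of_replace hfresh ?_ ?_ ?_
  · simp only [topStrand, middleStrand, bottomStrand, List.mem_append, mem_inOrder_iff]
    rintro p (((rfl | rfl) | rfl | rfl) | rfl | rfl) <;> simp
  · simp only [topStrand, middleStrand, bottomStrand, List.mem_append, mem_inOrder_iff]
    rintro c (rfl | rfl | rfl)
    exacts [⟨⟨c, true, sx⟩, by simp⟩, ⟨⟨c, true, sy⟩, by simp⟩, ⟨⟨c, true, sz⟩, by simp⟩]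
  · intro k a a' b b' c c' h1 h2 h3
    obtain ⟨k', hk', h1', h2', h3', hr⟩ := exists_transports_triangle (r := r) hne hxz hxy h1 h2 h3
    exact ⟨k', hk', h1', h2', h3', fun _ hb _ h0x h0y _ => hr hb h0x h0y⟩

theorem Colourable.r3' {x y z : ℕ} {sx sy sz α β γ : ℤˣ} (hxz : α * sx = γ * sz)
    (hxy : β * sx = γ * sy) {u v w : List Passage}
    (hw : IsGaussCode (topStrand x y sx sy α ++ u ++ bottomStrand y z sy sz γ ++ v ++
      middleStrand x z sx sz β ++ w))
    (h : Colourable t r (topStrand x y sx sy α ++ u ++ bottomStrand y z sy sz γ ++ v ++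
      middleStrand x z sx sz β ++ w)) :
    Colourable t r (topStrand x y sx sy (-α) ++ u ++ bottomStrand y z sy sz (-γ) ++ v ++
      middleStrand x z sx sz (-β) ++ w) := by
  have hperm : (topStrand x y sx sy α ++ u ++ bottomStrand y z sy sz γ ++ v ++
      middleStrand x z sx sz β ++ w).Perm (topStrand x y sx sy α ++ u ++
        middleStrand x z sx sz β ++ v ++ bottomStrand y z sy sz γ ++ w) := by
    classical
    rw [List.perm_iff_count]
    intro a
    simp only [List.count_append]
    ring
  obtain ⟨hne, hfresh⟩ := ((hw.perm hperm).perm (r3_perm (inOrder_perm _ _ _) (inOrder_perm _ _ _)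
    (inOrder_perm _ _ _) _ _ _)).triangle_ne
  refine h.of_replace hfresh ?_ ?_ ?_
  · simp only [topStrand, middleStrand, bottomStrand, List.mem_append, mem_inOrder_iff]
    rintro p (((rfl | rfl) | rfl | rfl) | rfl | rfl) <;> simp
  · simp only [topStrand, middleStrand, bottomStrand, List.mem_append, mem_inOrder_iff]
    rintro c (rfl | rfl | rfl)
    exacts [⟨⟨c, true, sx⟩, by simp⟩, ⟨⟨c, true, sy⟩, by simp⟩, ⟨⟨c, true, sz⟩, by simp⟩]
  · intro k a a' c c' b b' h1 h3 h2
    obtain ⟨k', hk', h1', h2', h3', hr⟩ := exists_transports_triangle (r := r) hne hxz hxy h1 h2 h3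
    exact ⟨k', hk', h1', h3', h2', fun _ _ hb h0x h0y _ => hr hb h0x h0y⟩

/-- Colourability with parameter `t` or `t⁻¹` does not depend on the direction of reading. -/
def ColourableUpToInv (t : Rˣ) (r : R) (w : List Passage) : Prop :=
  Colourable t r w ∨ Colourable t⁻¹ r w

theorem colourableUpToInv_iff_of_move {w w' : List Passage} (hw : IsGaussCode w)
    (hw' : IsGaussCode w') (h : ReidemeisterMove w w') :
    ColourableUpToInv t r w ↔ ColourableUpToInv t r w' := by
  cases h with
  | rotate u v => exact or_congr ⟨.rotate, .rotate⟩ ⟨.rotate, .rotate⟩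
  | reverse =>
    constructor
    · rintro (h | h)
      · exact .inr h.reverse
      · exact .inl (inv_inv t ▸ h.reverse)
    · rintro (h | h)
      · exact .inr (List.reverse_reverse w ▸ h.reverse)
      · exact .inl (by simpa using h.reverse)
  | rename σ => exact (or_congr (colourable_rename_iff σ) (colourable_rename_iff σ)).symm
  | r1 c o s u v => exact (or_congr (colourable_r1_iff hw') (colourable_r1_iff hw')).symm
  | r2 a b o s ε u v w => exact (or_congr (colourable_r2_iff hw') (colourable_r2_iff hw')).symm
  | r3 x y z sx sy sz α β γ hxz hxy u v w =>
    have hxz' : -α * sx = -γ * sz := by rw [neg_mul, neg_mul, hxz]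
    have hxy' : -β * sx = -γ * sy := by rw [neg_mul, neg_mul, hxy]
    have back : ∀ t : Rˣ, _ := fun t => Colourable.r3 (t := t) (r := r) hxz' hxy' hw'
    simp only [neg_neg] at back
    exact or_congr ⟨.r3 hxz hxy hw, back _⟩ ⟨.r3 hxz hxy hw, back _⟩
  | r3' x y z sx sy sz α β γ hxz hxy u v w =>
    have hxz' : -α * sx = -γ * sz := by rw [neg_mul, neg_mul, hxz]
    have hxy' : -β * sx = -γ * sy := by rw [neg_mul, neg_mul, hxy]
    have back : ∀ t : Rˣ, _ := fun t => Colourable.r3' (t := t) (r := r) hxz' hxy' hw'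
    simp only [neg_neg] at back
    exact or_congr ⟨.r3' hxz hxy hw, back _⟩ ⟨.r3' hxz hxy hw, back _⟩

theorem colourableUpToInv_iff_of_mk_eq {D D' : GaussCode}
    (h : Quotient.mk virtualKnotSetoid D = Quotient.mk virtualKnotSetoid D') :
    ColourableUpToInv t r D.word ↔ ColourableUpToInv t r D'.word := by
  have h' : Relation.EqvGen (fun D D' : GaussCode => ReidemeisterMove D.word D'.word) D D' :=
    Quotient.exact h
  clear h
  induction h' with
  | rel D D' h => exact colourableUpToInv_iff_of_move D.isGaussCode D'.isGaussCode h
  | refl D => rfl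
  | symm _ _ _ ih => exact ih.symm
  | trans _ _ _ _ _ ih1 ih2 => exact ih1.trans ih2

end Colouring

/-! ### The family of virtual knots -/

/-- The upper passages of the `j`-th gadget. Its crossings `4 * i + 1`, …, `4 * i + 4` for `j = i + 1`,
called `a`, `b`, `c`, `d` below, have the signs `+`, `+`, `-`, `-` and are passed in the order
`a`, `c`, `b`, `d`. For `j = 0` this is the upper passage of the single crossing `0` that locks the
chain. -/
def block : ℕ → List Passage
  | 0 => [⟨0, true, 1⟩]
  | i + 1 => [⟨4 * i + 1, true, 1⟩, ⟨4 * i + 3, true, -1⟩, ⟨4 * i + 2, true, 1⟩, ⟨4 * i + 4, true, -1⟩]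

/-- The lower passages of the gadgets `j`, `j - 1`, …, `0`, one gadget after the other; those of each
gadget, in the order `a`, `b`, `c`, `d`, enclose the upper passages of the next one. -/
def tail : ℕ → List Passage
  | 0 => [⟨0, false, 1⟩]
  | i + 1 => [⟨4 * i + 1, false, 1⟩, ⟨4 * i + 2, false, 1⟩] ++ block i ++
      [⟨4 * i + 3, false, -1⟩, ⟨4 * i + 4, false, -1⟩] ++ tail i

theorem crossing_le_of_mem {j : ℕ} {p : Passage} (hp : p ∈ block j ++ tail j) :
    p.crossing ≤ 4 * j := by
  induction j with
  | zero =>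
    simp only [block, tail, List.cons_append, List.nil_append, List.mem_cons, List.not_mem_nil,
      or_false] at hp
    rcases hp with rfl | rfl <;> simp
  | succ j ih =>
    rw [List.mem_append] at ih
    simp only [block, tail, List.mem_append, List.mem_cons, List.not_mem_nil, or_false] at hp
    rcases hp with (rfl | rfl | rfl | rfl) | (((rfl | rfl) | hp) | rfl | rfl) | hp
    all_goals first
      | (dsimp only; omega)
      | have := ih (.inl hp); omega
      | have := ih (.inr hp); omega

theorem chain_perm (a b c d a' b' c' d' : Passage) (u v : List Passage) :
    ([a, c, b, d] ++ ([a', b'] ++ u ++ [c', d'] ++ v)).Perm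
      (a :: a' :: b :: b' :: c :: c' :: d :: d' :: (u ++ v)) := by
  classical
  rw [List.perm_iff_count]
  intro x
  simp only [List.count_append, List.count_cons, List.count_nil]
  ring

theorem isGaussCode_chain (j : ℕ) : IsGaussCode (block j ++ tail j) := by
  induction j with
  | zero => exact isGaussCode_cons_cons_iff.2 ⟨⟨by simp, by simp⟩, by simp⟩
  | succ j ih =>
    refine IsGaussCode.perm ?_ (chain_perm _ _ _ _ _ _ _ _ _ _).symm
    have key : ∀ i p, p ∈ block j ++ tail j → p.crossing ≠ 4 * j + (i + 1) := fun i p hp => by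
      have := crossing_le_of_mem hp
      omega
    refine isGaussCode_cons_cons_iff.2 ⟨isGaussCode_cons_cons_iff.2 ⟨isGaussCode_cons_cons_iff.2
      ⟨isGaussCode_cons_cons_iff.2 ⟨ih, key 3⟩, ?_⟩, ?_⟩, ?_⟩
    · rintro p (_ | ⟨_, _ | ⟨_, hp⟩⟩)
      exacts [by simp, by simp, key 2 p hp]
    · rintro p (_ | ⟨_, _ | ⟨_, _ | ⟨_, _ | ⟨_, hp⟩⟩⟩⟩)
      exacts [by simp, by simp, by simp, by simp, key 1 p hp]
    · rintro p (_ | ⟨_, _ | ⟨_, _ | ⟨_, _ | ⟨_, _ | ⟨_, _ | ⟨_, hp⟩⟩⟩⟩⟩⟩)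
      exacts [by simp, by simp, by simp, by simp, by simp, by simp, key 0 p hp]

/-- The chain of `j` gadgets. -/
def chain (j : ℕ) : GaussCode := ⟨block j ++ tail j, isGaussCode_chain j⟩

/-- Four crossings paired as in a gadget, with nothing between the lower passages, cancel. -/
theorem exists_mk_eq_of_gadget (i : ℕ) (A B Y : List Passage)
    (h : IsGaussCode (A ++ block (i + 1) ++ B ++ [⟨4 * i + 1, false, 1⟩, ⟨4 * i + 2, false, 1⟩] ++
      [⟨4 * i + 3, false, -1⟩, ⟨4 * i + 4, false, -1⟩] ++ Y)) :
    ∃ h' : IsGaussCode (A ++ B ++ Y),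
      Quotient.mk virtualKnotSetoid ⟨_, h⟩ = Quotient.mk virtualKnotSetoid ⟨_, h'⟩ := by
  -- first `b` and `c`, which are adjacent at both of their passages, in opposite orders
  have e1 : A ++ block (i + 1) ++ B ++ [⟨4 * i + 1, false, 1⟩, ⟨4 * i + 2, false, 1⟩] ++
      [⟨4 * i + 3, false, -1⟩, ⟨4 * i + 4, false, -1⟩] ++ Y =
      (A ++ [⟨4 * i + 1, true, 1⟩]) ++ [⟨4 * i + 3, true, -1⟩, ⟨4 * i + 2, true, -(-1)⟩] ++
        ([⟨4 * i + 4, true, -1⟩] ++ B ++ [⟨4 * i + 1, false, 1⟩]) ++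
        inOrder (-1) ⟨4 * i + 3, !true, -1⟩ ⟨4 * i + 2, !true, -(-1)⟩ ++
        ([⟨4 * i + 4, false, -1⟩] ++ Y) := by
    simp [block, inOrder]
  -- then `a` and `d`
  have e2 : (A ++ [⟨4 * i + 1, true, 1⟩]) ++
        ([⟨4 * i + 4, true, -1⟩] ++ B ++ [⟨4 * i + 1, false, 1⟩]) ++
        ([⟨4 * i + 4, false, -1⟩] ++ Y) =
      A ++ [⟨4 * i + 1, true, 1⟩, ⟨4 * i + 4, true, -1⟩] ++ B ++
        inOrder 1 ⟨4 * i + 1, !true, 1⟩ ⟨4 * i + 4, !true, -1⟩ ++ Y := by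
    simp [inOrder]
  revert h
  rw [e1]
  intro h
  obtain ⟨h1, h2⟩ := exists_mk_eq_of_r2 _ _ _ _ _ _ _ _ h
  rw [h2]
  clear h2 h
  revert h1
  rw [e2]
  exact fun h => exists_mk_eq_of_r2 _ _ _ _ _ _ _ _ h

/-- In the chain of `j ≥ i` gadgets, the gadgets `i + 1`, …, `j` occupy the positions `A` and `B` around
the upper passages of the gadget `i`. If these are missing, then, whatever the remaining part `Y` is, all
gadgets in `A` and `B` cancel, each of them removing the obstacle from the one above. -/
theorem exists_context {i j : ℕ} (hij : i ≤ j) :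
    ∃ A B : List Passage, block j ++ tail j = A ++ block i ++ B ++ tail i ∧
      ∀ (Y : List Passage) (h : IsGaussCode (A ++ B ++ Y)), ∃ h' : IsGaussCode Y,
        Quotient.mk virtualKnotSetoid ⟨_, h⟩ = Quotient.mk virtualKnotSetoid ⟨_, h'⟩ := by
  induction hij using Nat.decreasingInduction with
  | self => exact ⟨[], [], by simp, fun Y h => ⟨h, rfl⟩⟩
  | of_succ i hi ih =>
    obtain ⟨A, B, hAB, hY⟩ := ih
    refine ⟨A ++ block (i + 1) ++ B ++ [⟨4 * i + 1, false, 1⟩, ⟨4 * i + 2, false, 1⟩],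
      [⟨4 * i + 3, false, -1⟩, ⟨4 * i + 4, false, -1⟩], ?_, fun Y h => ?_⟩
    · rw [hAB]
      simp [tail]
    · obtain ⟨h1, h2⟩ := exists_mk_eq_of_gadget i A B Y h
      obtain ⟨h3, h4⟩ := hY Y h1
      exact ⟨h3, h2.trans h4⟩

/-- The arc shift at the crossings `c` and `b` of the gadget `i + 1` makes this gadget and all gadgets
above it cancel. -/
theorem arcShiftAdjacent_chain {i j : ℕ} (hij : i < j) :
    ArcShiftAdjacent (Quotient.mk _ (chain j)) (Quotient.mk _ (chain i)) := by
  obtain ⟨A, B, hAB, hY⟩ := exists_context (Nat.succ_le_of_lt hij)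
  have hg := isGaussCode_chain j
  rw [hAB] at hg
  have hperm : (A ++ block (i + 1) ++ B ++ tail (i + 1)).Perm
      (block (i + 1) ++ ([⟨4 * i + 1, false, 1⟩, ⟨4 * i + 2, false, 1⟩] ++ (A ++ B ++ block i) ++
        [⟨4 * i + 3, false, -1⟩, ⟨4 * i + 4, false, -1⟩] ++ tail i)) := by
    classical
    rw [List.perm_iff_count]
    intro x
    simp only [tail, List.count_append]
    ring
  -- the crossings `b` and `c` occur in the gadget `i + 1` only
  have hfresh : ∀ p ∈ A ++ B ++ block i ++ tail i,
      p.crossing ≠ 4 * i + 2 ∧ p.crossing ≠ 4 * i + 3 := by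
    have h0 := (hg.perm hperm).perm (chain_perm _ _ _ _ _ _ _ _ _ _)
    have h1 := (isGaussCode_cons_cons_iff (o := true).1 h0).1
    obtain ⟨h2, hb⟩ := isGaussCode_cons_cons_iff (o := true).1 h1
    obtain ⟨-, hc⟩ := isGaussCode_cons_cons_iff (o := true).1 h2
    exact fun p hp => ⟨hb p (by simp [-List.append_assoc, hp]),
      hc p (by simp [-List.append_assoc, hp])⟩
  have hid : ∀ l : List Passage, (∀ p ∈ l, p ∈ A ++ B ++ block i ++ tail i) →
      flipSign (4 * i + 3) (flipSign (4 * i + 2) l) = l := fun l hl => by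
    rw [flipSign_eq_self (w := l) fun p hp => (hfresh p (hl p hp)).1,
      flipSign_eq_self fun p hp => (hfresh p (hl p hp)).2]
  have hword : flipSign (4 * i + 3) (flipSign (4 * i + 2) ((A ++ [⟨4 * i + 1, true, 1⟩]) ++
      [⟨4 * i + 2, true, 1⟩, ⟨4 * i + 3, true, -1⟩] ++
        ([⟨4 * i + 4, true, -1⟩] ++ B ++ tail (i + 1)))) =
      A ++ [⟨4 * i + 1, true, 1⟩, ⟨4 * i + 2, true, -1⟩] ++
        ([⟨4 * i + 3, true, 1⟩, ⟨4 * i + 4, true, -1⟩] ++ B) ++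
        inOrder 1 ⟨4 * i + 1, !true, 1⟩ ⟨4 * i + 2, !true, -1⟩ ++
        (block i ++ [⟨4 * i + 3, false, 1⟩, ⟨4 * i + 4, false, -1⟩] ++ tail i) := by
    simp only [tail, flipSign_append]
    rw [hid A (by simp +contextual), hid B (by simp +contextual), hid (block i) (by simp +contextual),
      hid (tail i) (by simp +contextual)]
    simp [flipSign, inOrder]
  have hg' : IsGaussCode (flipSign (4 * i + 3) (flipSign (4 * i + 2)
      ((A ++ [⟨4 * i + 1, true, 1⟩]) ++ [⟨4 * i + 2, true, 1⟩, ⟨4 * i + 3, true, -1⟩] ++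
        ([⟨4 * i + 4, true, -1⟩] ++ B ++ tail (i + 1))))) := by
    refine (IsGaussCode.perm hg ?_).flipSign _ |>.flipSign _
    classical
    rw [List.perm_iff_count]
    intro x
    simp only [block, List.count_append, List.count_cons, List.count_nil]
    ring
  refine ⟨chain j, ⟨_, hg'⟩, rfl, ?_, .classical _ _ ⟨4 * i + 3, true, -1⟩ ⟨4 * i + 2, true, 1⟩
    (A ++ [⟨4 * i + 1, true, 1⟩]) ([⟨4 * i + 4, true, -1⟩] ++ B ++ tail (i + 1)) (by simp) ?_ rfl⟩
  · unfold GaussCode.Represents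
    revert hg'
    rw [hword]
    intro hg'
    obtain ⟨h1, e1⟩ := exists_mk_eq_of_r2 _ _ _ _ _ _ _ _ hg'
    rw [e1]
    clear e1 hg'
    have e : A ++ ([⟨4 * i + 3, true, 1⟩, ⟨4 * i + 4, true, -1⟩] ++ B) ++
        (block i ++ [⟨4 * i + 3, false, 1⟩, ⟨4 * i + 4, false, -1⟩] ++ tail i) =
        A ++ [⟨4 * i + 3, true, 1⟩, ⟨4 * i + 4, true, -1⟩] ++ (B ++ block i) ++
        inOrder 1 ⟨4 * i + 3, !true, 1⟩ ⟨4 * i + 4, !true, -1⟩ ++ tail i := by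
      simp [inOrder]
    revert h1
    rw [e]
    intro h1
    obtain ⟨h2, e2⟩ := exists_mk_eq_of_r2 _ _ _ _ _ _ _ _ h1
    rw [e2]
    clear e2 h1 e
    have e : A ++ (B ++ block i) ++ tail i = A ++ B ++ (block i ++ tail i) := by simp
    revert h2
    rw [e]
    intro h2
    exact (hY _ h2).2
  · change block j ++ tail j = _
    rw [hAB]
    simp [block]

/-! ### Colourings of the chains -/

section Colouring

variable {R : Type*} [CommRing R] {t : Rˣ} {k : ℕ → R} {r : R}

/-- The two colours `x` and `z` at the upper passages of a gadget and in front of its lower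
passages determine the colours at the gadget and at the upper passages of the next one. -/
theorem transports_gadget_iff {i : ℕ} {x y z z' : R} :
    Transports t k x (block (i + 1)) y ∧ Transports t k z (tail (i + 1)) z' ↔
      (k (4 * i + 1) = x ∧ k (4 * i + 2) = x ∧ k (4 * i + 3) = -x ∧ k (4 * i + 4) = -x) ∧ x = y ∧
        ∃ w, Transports t k (t ^ 2 * z + (1 + t) ^ 2 * x) (block i) w ∧
          Transports t k
            ((t⁻¹ : Rˣ) ^ 2 * (w - (1 + t) ^ 2 * x)) (tail i) z' := by
  have hu : (t : R) * ((t⁻¹ : Rˣ) : R) = 1 := by simp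
  have hb : Transports t k x (block (i + 1)) y ↔
      (k (4 * i + 1) = x ∧ k (4 * i + 2) = x ∧ k (4 * i + 3) = -x ∧ k (4 * i + 4) = -x) ∧
        x = y := by
    simp [block]
    tauto
  rw [hb, and_assoc]
  refine and_congr_right fun ⟨h1, h2, h3, h4⟩ => and_congr_right fun _ => ?_
  simp only [tail, transports_append]
  constructor
  · rintro ⟨w₂, ⟨w₁, ⟨w₀, ha, hw⟩, hc⟩, ht⟩
    simp only [transports_under, transports_nil, signPow_one, signPow_neg_one, h1, h2, h3, h4]
      at ha hc
    refine ⟨w₁, ?_, ?_⟩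
    · convert hw using 1
      rw [← ha]
      ring
    · convert ht using 1
      rw [← hc]
      generalize ((t⁻¹ : Rˣ) : R) = t' at hu ⊢
      grind
  · rintro ⟨w, hw, ht⟩
    refine ⟨_, ⟨w, ⟨_, ?_, hw⟩, ?_⟩, ht⟩
    · simp only [transports_under, transports_nil, signPow_one, h1, h2]
      ring
    · simp only [transports_under, transports_nil, signPow_neg_one, h3, h4]
      generalize ((t⁻¹ : Rˣ) : R) = t' at hu ⊢
      grind

/-- The colour behind a chain of `j ≥ 1` gadgets with colours `x` and `z` as in
`transports_gadget_iff`. -/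
def exitColour (t : Rˣ) (j : ℕ) (x z : R) : R :=
  z + (t - 1) * (t⁻¹ : Rˣ) * (1 + t) ^ (2 * j) * (t * z + (t + 2) * x)

theorem exitColour_succ (j : ℕ) (x z : R) :
    exitColour t (j + 1) x z = exitColour t j (t ^ 2 * z + (1 + t) ^ 2 * x) z := by
  unfold exitColour
  ring

theorem Transports.eq_exitColour {j : ℕ} {x y z z' : R} (h1 : Transports t k x (block (j + 1)) y)
    (h2 : Transports t k z (tail (j + 1)) z') :
    y = x ∧ z' = exitColour t (j + 1) x z ∧ (r * x = 0 → r * z = 0 →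
      ∀ p ∈ block (j + 1) ++ tail (j + 1), r * k p.crossing = 0) := by
  have hu : (t : R) * ((t⁻¹ : Rˣ) : R) = 1 := by simp
  induction j generalizing x y z z' with
  | zero =>
    obtain ⟨⟨ka, kb, kc, kd⟩, rfl, w, hw, ht⟩ := transports_gadget_iff.1 ⟨h1, h2⟩
    simp only [block, transports_over, transports_nil] at hw
    obtain ⟨k0, rfl⟩ := hw
    simp only [tail, transports_under, transports_nil, signPow_one, k0] at ht
    refine ⟨rfl, ?_, fun hx hz p hp => ?_⟩
    · rw [← ht, exitColour]
      generalize ((t⁻¹ : Rˣ) : R) = t' at hu ⊢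
      grind
    · simp only [block, tail, List.mem_append, List.mem_cons, List.not_mem_nil, or_false] at hp
      rcases hp with (rfl | rfl | rfl | rfl) | (((rfl | rfl) | rfl) | rfl | rfl) | rfl
      all_goals simp only [ka, kb, kc, kd, k0]
      all_goals first
        | exact hx
        | linear_combination -hx
        | linear_combination (t : R) ^ 2 * hz + (1 + (t : R)) ^ 2 * hx
  | succ j ih =>
    obtain ⟨⟨ka, kb, kc, kd⟩, rfl, w, hw, ht⟩ := transports_gadget_iff.1 ⟨h1, h2⟩
    obtain ⟨rfl, he, hr⟩ := ih hw ht
    have hz' : ((t⁻¹ : Rˣ) : R) ^ 2 * ((t : R) ^ 2 * z + (1 + (t : R)) ^ 2 * x -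
        (1 + (t : R)) ^ 2 * x) = z := by
      linear_combination z * ((t : R) * ((t⁻¹ : Rˣ) : R) + 1) * hu
    rw [hz'] at he hr
    refine ⟨rfl, by rw [he, exitColour_succ (j + 1)], fun hx hz p hp => ?_⟩
    have hr' := hr (by linear_combination (t : R) ^ 2 * hz + (1 + (t : R)) ^ 2 * hx) hz
    rw [block, tail] at hp
    simp only [List.mem_append, List.mem_cons, List.not_mem_nil, or_false] at hp hr'
    rcases hp with (rfl | rfl | rfl | rfl) | (((rfl | rfl) | hp) | rfl | rfl) | hp
    all_goals first
      | exact hr' p (.inl hp)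
      | exact hr' p (.inr hp)
      | simp only [ka, kb, kc, kd]
    all_goals first
      | exact hx
      | linear_combination -hx

theorem exists_transports_chain (t : Rˣ) (j : ℕ) (x : R) :
    ∃ y, ∀ z, ∃ (k : ℕ → R) (z' : R), Transports t k x (block j) y ∧
      Transports t k z (tail j) z' := by
  induction j generalizing x with
  | zero =>
    exact ⟨-x, fun z => ⟨fun _ => x, _, by simp [block], transports_under.2 (transports_nil.2 rfl)⟩⟩
  | succ i ih =>
    refine ⟨x, fun z => ?_⟩
    obtain ⟨w, hw⟩ := ih (t ^ 2 * z + (1 + t) ^ 2 * x)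
    obtain ⟨k₀, z', h1, h2⟩ := hw ((t⁻¹ : Rˣ) ^ 2 * (w - (1 + t) ^ 2 * x))
    -- the colours of the lower gadgets, extended to one more gadget
    obtain ⟨k, hk⟩ : ∃ k : ℕ → R, k = fun n =>
        if n ≤ 4 * i then k₀ n else if n ≤ 4 * i + 2 then x else -x := ⟨_, rfl⟩
    have hk₀ : ∀ p ∈ block i ++ tail i, k₀ p.crossing = k p.crossing := fun p hp => by
      simp [hk, crossing_le_of_mem hp]
    refine ⟨k, z', transports_gadget_iff.2 ⟨by simp [hk], rfl, w, ?_, ?_⟩⟩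
    · exact (transports_congr fun p hp => hk₀ p (by simp [hp])).1 h1
    · exact (transports_congr fun p hp => hk₀ p (by simp [hp])).1 h2

theorem colourable_chain {j : ℕ} (hj : 1 ≤ j) (hr : r ≠ 0)
    (h : 2 * ((t : R) - 1) * (1 + t) ^ (2 * j + 1) = 0) : Colourable t r (chain j).word := by
  obtain ⟨j, rfl⟩ := Nat.exists_eq_add_of_le' hj
  obtain ⟨y, hy⟩ := exists_transports_chain t (j + 1) 1
  obtain ⟨k, z', h1, h2⟩ := hy 1
  obtain ⟨rfl, rfl, -⟩ := h1.eq_exitColour (r := 0) h2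
  refine ⟨k, 1, transports_append.2 ⟨1, h1, ?_⟩, fun h => absurd (by simpa using h) hr⟩
  convert h2 using 1
  rw [exitColour]
  linear_combination (-((t⁻¹ : Rˣ) : R)) * h

theorem not_colourable_chain {j : ℕ} (hj : 1 ≤ j)
    (h : 2 * ((t : R) - 1) * (1 + t) ^ (2 * j + 1) ∣ r) : ¬Colourable t r (chain j).word := by
  obtain ⟨j, rfl⟩ := Nat.exists_eq_add_of_le' hj
  rintro ⟨k, x, hk, hr⟩
  obtain ⟨y, h1, h2⟩ := transports_append.1 hk
  obtain ⟨rfl, he, h0⟩ := h1.eq_exitColour (r := r) h2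
  have hu : (t : R) * ((t⁻¹ : Rˣ) : R) = 1 := by simp
  have hy : r * y = 0 := by
    obtain ⟨q, rfl⟩ := h
    rw [exitColour] at he
    linear_combination (-q * (t : R)) * he -
      q * (2 * ((t : R) - 1) * (1 + t) ^ (2 * (j + 1) + 1)) * y * hu
  obtain ⟨p, hp, hp'⟩ := hr hy
  exact hp' (h0 hy hy p hp)

end Colouring

theorem mk_chain_ne_of_lt {i j : ℕ} (hi : 1 ≤ i) (hij : i < j) :
    Quotient.mk virtualKnotSetoid (chain j) ≠ Quotient.mk virtualKnotSetoid (chain i) := by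
  intro h
  -- For this exponent the chain of `j` gadgets has the colouring with `z = 1`, while every colouring of
  -- the chain of `i` gadgets is annihilated by `3 ^ (2 * j)`, because `2 * i + 1 ≤ 2 * j`.
  let R := ZMod (3 ^ (2 * j + 1))
  have h3 : (3 : R) ^ (2 * j + 1) = 0 := by
    have := ZMod.natCast_self (3 ^ (2 * j + 1))
    push_cast at this
    exact this
  have hr : (3 : R) ^ (2 * j) ≠ 0 := by
    intro h0
    have h1 : ((3 ^ (2 * j) : ℕ) : R) = 0 := by push_cast; exact h0
    rw [ZMod.natCast_eq_zero_iff] at h1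
    exact absurd (Nat.le_of_dvd (by positivity) h1)
      (not_le.2 (Nat.pow_lt_pow_right (by norm_num) (by omega)))
  have h2 : IsUnit (2 : R) := by
    have := (ZMod.isUnit_iff_coprime 2 (3 ^ (2 * j + 1))).2 (Nat.Coprime.pow_right _ (by norm_num))
    exact_mod_cast this
  obtain ⟨t, ht⟩ := h2
  have hu : (t : R) * ((t⁻¹ : Rˣ) : R) = 1 := by simp
  obtain ⟨d, hd⟩ : ∃ d, (3 : R) ^ (2 * j) = 3 ^ (2 * i + 1) * 3 ^ d :=
    ⟨2 * j - (2 * i + 1), by rw [← pow_add]; congr 1; omega⟩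
  have hc : ColourableUpToInv t ((3 : R) ^ (2 * j)) (chain j).word := by
    refine .inl (colourable_chain (by omega) hr ?_)
    rw [ht]
    linear_combination 2 * h3
  rcases (colourableUpToInv_iff_of_mk_eq h).1 hc with h' | h'
  · refine not_colourable_chain hi ⟨((t⁻¹ : Rˣ) : R) * 3 ^ d, ?_⟩ h'
    rw [ht] at hu ⊢
    rw [hd]
    linear_combination (-(3 : R) ^ (2 * i + 1) * 3 ^ d) * hu
  · refine not_colourable_chain hi ⟨-(t : R) ^ (2 * i + 1) * 3 ^ d, ?_⟩ h'
    rw [ht] at hu ⊢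
    generalize ((t⁻¹ : Rˣ) : R) = s at hu ⊢
    have e1 : s - 1 = -s := by linear_combination hu
    have e2 : 1 + s = 3 * s := by linear_combination -hu
    rw [e1, e2, hd]
    have e3 : (2 : R) ^ (2 * i + 1) * s ^ (2 * i + 1) = 1 := by rw [← mul_pow, hu, one_pow]
    rw [mul_pow]
    linear_combination (-(3 : R) ^ (2 * i + 1) * 3 ^ d) * (2 * s * e3 + hu)

theorem theorem3p2 :
    ∃ VK : ℕ → VirtualKnot,
      ∀ t s : ℕ, 1 ≤ t → 1 ≤ s → t ≠ s → arcShiftDist (VK t) (VK s) = 1 := by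
  refine ⟨fun n => Quotient.mk _ (chain n), fun i j hi hj hij => ?_⟩
  rcases lt_or_gt_of_ne hij with h | h
  · exact arcShiftDist_eq_one (mk_chain_ne_of_lt hi h).symm (arcShiftAdjacent_chain h).symm
  · exact arcShiftDist_eq_one (mk_chain_ne_of_lt hj h) (arcShiftAdjacent_chain h)
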